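/- Conventions. A simplicial tree is a (non-empty) one-dimensional simplicial complex whose underlying graph is connected and has no cycles (a single vertex is allowed), equipped with the path metric in which every edge is isometric to $[0,1]$. It is countable if it has countably many vertices, and locally finite if every vertex has finitely many neighbours. For $L\geqslant 1$, $C\geqslant 0$, a map $f:X\to Y$ of metric spaces is an $(L,C)$-quasi-isometry if $\frac1L d_X(x_1,x_2)-C\leqslant d_Y(f(x_1),f(x_2))\leqslant L\,d_X(x_1,x_2)+C$ for all $x_1,x_2\in X$, and for every $y\in Y$ there is $x\in X$ with $d_Y(f(x),y)\leqslant C$. A map $A:G\times X\to X$ is an $(L,C)$-quasi-action of a group $G$ on a metric space $X$ if $A(g,-)$ is an $(L,C)$-quasi-isometry for every $g\in G$ and $d(A(g,A(h,x)),A(gh,x))\leqslant C$ for all $g,h\in G$, $x\in X$. It is cobounded if there is $K\geqslant 0$ such that for all $x,y\in X$ there is $g\in G$ with $d(A(g,x),y)\leqslant K$. Quasi-actions $A_X$ on $X$ and $A_Y$ on $Y$ of the same group $G$ are quasi-conjugate if there are a map $f:X\to Y$ that is a quasi-isometry (for some constants) and a constant $K\geqslant 0$ with $d_Y(f(A_X(g,x)),A_Y(g,f(x)))\leqslant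 K$ for all $g\in G$, $x\in X$. Corollary. Let $G$ be a finitely generated group. (1) If $A$ is a cobounded $(L,C)$-quasi-action of $G$ on a countable simplicial tree, for some $L\geqslant 1$, $C\geqslant 0$, then there are $C'\geqslant 0$ and a $(1,C')$-quasi-action of $G$ on a countable simplicial tree that is quasi-conjugate to $A$. (2) If $A$ is a cobounded $(L,C)$-quasi-action of $G$ on a locally finite simplicial tree, for some $L\geqslant 1$, $C\geqslant 0$, then there are $C'\geqslant 0$ and a $(1,C')$-quasi-action of $G$ on a locally finite simplicial tree that is quasi-conjugate to $A$. -/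

import Mathlib

universe u w

/-- A simplicial tree, presented combinatorially: a one-dimensional (abstract) simplicial complex
is a simple graph, and it is a tree when it is non-empty, connected and without cycles.  A single
vertex is allowed.  There is no restriction on the number of neighbours of a vertex. -/
structure SimplicialTree : Type (u + 1) where
  /-- the vertices -/
  V : Type u
  /-- the edges -/
  graph : SimpleGraph V
  isTree : graph.IsTree

namespace SimplicialTree

/-- The simplicial tree has countably many vertices. -/
def IsCountable (T : SimplicialTree.{u}) : Prop := Countable T.V

/-- Every vertex has finitely many neighbours. -/
def IsLocallyFinite (T : SimplicialTree.{u}) : Prop :=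
  ∀ v : T.V, (T.graph.neighborSet v).Finite

/-- The points of the geometric realization, in barycentric coordinates: finitely supported
functions on the vertices with non-negative values of sum `1`, supported in a single vertex
or in the two ends of an edge. -/
@[ext]
structure Point (T : SimplicialTree.{u}) : Type u where
  coord : T.V →₀ ℝ
  nonneg : ∀ w, 0 ≤ coord w
  sum_eq_one : (coord.sum fun _ a => a) = 1
  mem_cell : ∃ u v, (u = v ∨ T.graph.Adj u v) ∧ ∀ w, coord w ≠ 0 → w = u ∨ w = v

/-- `p` lies on the closed edge between `u` and `v`. -/
def OnEdge (T : SimplicialTree.{u}) (u v : T.V) (p : T.Point) : Prop :=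
  T.graph.Adj u v ∧ ∀ w, p.coord w ≠ 0 → w = u ∨ w = v

/-- `T.HasPath p q ℓ`: there is a path of length `ℓ` from `p` to `q` that is a finite concatenation
of segments, each contained in a closed edge.  The edge between `u` and `v` is identified with
`[0, 1]` by the coordinate at `u`, so that a segment in it from `p` to `q` has length
`|p u - q u|`. -/
inductive HasPath (T : SimplicialTree.{u}) : T.Point → T.Point → ℝ → Prop
  | nil (p : T.Point) : HasPath T p p 0
  | cons {p q r : T.Point} {u v : T.V} {l : ℝ} (hp : T.OnEdge u v p) (hq : T.OnEdge u v q)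
      (h : HasPath T q r l) : HasPath T p r (|p.coord u - q.coord u| + l)

/-- The path metric: the infimum of the lengths of the paths between two points. -/
noncomputable def pathDist (T : SimplicialTree.{u}) (p q : T.Point) : ℝ :=
  sInf {l : ℝ | T.HasPath p q l}

variable {T : SimplicialTree.{u}}

theorem OnEdge.add_eq_one {u v : T.V} {p : T.Point} (h : T.OnEdge u v p) :
    p.coord u + p.coord v = 1 := by
  classical
  have hs : p.coord.support ⊆ {u, v} := by
    intro w hw
    simpa using h.2 w (Finsupp.mem_support_iff.1 hw)
  have h1 := p.sum_eq_one
  rwa [Finsupp.sum_of_support_subset _ hs _ (by simp), Finset.sum_pair h.1.ne] at h1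

/-- A segment in an edge has length at least the change of any coordinate. -/
theorem OnEdge.abs_sub_le {u v : T.V} {p q : T.Point} (hp : T.OnEdge u v p) (hq : T.OnEdge u v q)
    (w : T.V) : |p.coord w - q.coord w| ≤ |p.coord u - q.coord u| := by
  by_cases hu : w = u
  · rw [hu]
  by_cases hv : w = v
  · have h1 := hp.add_eq_one
    have h2 := hq.add_eq_one
    rw [hv, show p.coord v - q.coord v = -(p.coord u - q.coord u) by linarith, abs_neg]
  · have h1 : p.coord w = 0 := by
      by_contra h
      rcases hp.2 w h with h | h <;> contradiction
    have h2 : q.coord w = 0 := by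
      by_contra h
      rcases hq.2 w h with h | h <;> contradiction
    simp [h1, h2]

theorem HasPath.abs_sub_le {p q : T.Point} {l : ℝ} (h : T.HasPath p q l) (w : T.V) :
    |p.coord w - q.coord w| ≤ l := by
  induction h with
  | nil p => simp
  | cons hp hq _ ih =>
    exact (_root_.abs_sub_le _ _ _).trans (add_le_add (hp.abs_sub_le hq w) ih)

theorem HasPath.trans {p q r : T.Point} {l m : ℝ} (h : T.HasPath p q l) (h' : T.HasPath q r m) :
    T.HasPath p r (l + m) := by
  induction h with
  | nil p => simpa using h'
  | cons hp hq _ ih =>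
    rw [add_assoc]
    exact .cons hp hq (ih h')

theorem HasPath.symm {p q : T.Point} {l : ℝ} (h : T.HasPath p q l) : T.HasPath q p l := by
  induction h with
  | nil p => exact .nil p
  | cons hp hq _ ih =>
    have := ih.trans (.cons hq hp (.nil _))
    rwa [add_zero, abs_sub_comm, add_comm] at this

theorem HasPath.nonneg {p q : T.Point} {l : ℝ} (h : T.HasPath p q l) : 0 ≤ l := by
  induction h with
  | nil p => exact le_rfl
  | cons _ _ _ ih => positivity

/-- A vertex as a point of the realization. -/
noncomputable def vertex (T : SimplicialTree.{u}) (v : T.V) : T.Point where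
  coord := Finsupp.single v 1
  nonneg w := by
    classical
    rw [Finsupp.single_apply]
    split_ifs <;> norm_num
  sum_eq_one := by simp
  mem_cell := ⟨v, v, Or.inl rfl, fun w hw => by
    classical
    rw [Finsupp.single_apply] at hw
    by_contra h
    exact hw (if_neg fun h' => h (Or.inl h'.symm))⟩

theorem onEdge_vertex_left {u v : T.V} (h : T.graph.Adj u v) : T.OnEdge u v (T.vertex u) := by
  classical
  refine ⟨h, fun w hw => ?_⟩
  by_contra h'
  exact hw ((Finsupp.single_apply).trans (if_neg fun h'' => h' (Or.inl h''.symm)))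

theorem OnEdge.swap {u v : T.V} {p : T.Point} (h : T.OnEdge u v p) : T.OnEdge v u p :=
  ⟨h.1.symm, fun w hw => (h.2 w hw).symm⟩

theorem exists_hasPath_vertex {u v : T.V} (h : T.graph.Walk u v) :
    ∃ l, T.HasPath (T.vertex u) (T.vertex v) l := by
  induction h with
  | nil => exact ⟨_, .nil _⟩
  | cons h _ ih =>
    obtain ⟨l, hl⟩ := ih
    exact ⟨_, .cons (onEdge_vertex_left h) (onEdge_vertex_left h.symm).swap hl⟩

theorem exists_hasPath_to_vertex (p : T.Point) : ∃ v l, T.HasPath p (T.vertex v) l := by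
  classical
  obtain ⟨u, v, huv | huv, h⟩ := p.mem_cell
  · subst huv
    have hs : p.coord.support ⊆ {u} := by
      intro w hw
      simpa using h w (Finsupp.mem_support_iff.1 hw)
    have h1 := p.sum_eq_one
    rw [Finsupp.sum_of_support_subset _ hs _ (by simp), Finset.sum_singleton] at h1
    have hp : p = T.vertex u := by
      ext w
      change p.coord w = Finsupp.single u 1 w
      rw [Finsupp.single_apply]
      split_ifs with hw
      · rw [← hw, h1]
      · by_contra h'
        rcases h w h' with h | h <;> exact hw h.symm
    exact ⟨u, 0, hp ▸ .nil _⟩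
  · exact ⟨u, _, .cons ⟨huv, h⟩ (onEdge_vertex_left huv) (.nil _)⟩

theorem exists_hasPath (p q : T.Point) : ∃ l, T.HasPath p q l := by
  obtain ⟨u, l, hl⟩ := exists_hasPath_to_vertex p
  obtain ⟨v, m, hm⟩ := exists_hasPath_to_vertex q
  obtain ⟨w⟩ := T.isTree.connected.preconnected u v
  obtain ⟨k, hk⟩ := exists_hasPath_vertex w
  exact ⟨_, hl.trans (hk.trans hm.symm)⟩

theorem pathDist_le {p q : T.Point} {l : ℝ} (h : T.HasPath p q l) : T.pathDist p q ≤ l :=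
  csInf_le ⟨0, fun _ h => HasPath.nonneg h⟩ h

theorem le_pathDist {p q : T.Point} {b : ℝ} (h : ∀ l, T.HasPath p q l → b ≤ l) :
    b ≤ T.pathDist p q :=
  le_csInf (exists_hasPath p q) h

/-- The geometric realization of a simplicial tree, with the path metric. -/
noncomputable instance : MetricSpace T.Point where
  dist := T.pathDist
  dist_self p := le_antisymm (pathDist_le (.nil p)) (le_pathDist fun _ h => h.nonneg)
  dist_comm p q := le_antisymm (le_pathDist fun _ h => pathDist_le h.symm)
    (le_pathDist fun _ h => pathDist_le h.symm)
  dist_triangle p q r := by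
    rw [← sub_le_iff_le_add]
    refine le_pathDist fun l hl => ?_
    rw [sub_le_comm]
    refine le_pathDist fun m hm => ?_
    rw [sub_le_iff_le_add']
    exact pathDist_le (hl.trans hm)
  eq_of_dist_eq_zero {p q} h := by
    ext w
    have h1 : |p.coord w - q.coord w| ≤ T.pathDist p q := le_pathDist fun _ h => h.abs_sub_le w
    exact sub_eq_zero.1 (abs_nonpos_iff.1 (h1.trans_eq h))

end SimplicialTree

/-- `f` is an `(L, C)`-quasi-isometry. -/
structure IsQuasiIsometry {X : Type*} {Y : Type*} [MetricSpace X] [MetricSpace Y]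
    (L C : ℝ) (f : X → Y) : Prop where
  one_le : 1 ≤ L
  nonneg : 0 ≤ C
  lower : ∀ x₁ x₂ : X, 1 / L * dist x₁ x₂ - C ≤ dist (f x₁) (f x₂)
  upper : ∀ x₁ x₂ : X, dist (f x₁) (f x₂) ≤ L * dist x₁ x₂ + C
  coarselySurjective : ∀ y : Y, ∃ x : X, dist (f x) y ≤ C

/-- `A` is an `(L, C)`-quasi-action of the group `G` on `X`. -/
structure IsQuasiAction {G : Type*} {X : Type*} [Group G] [MetricSpace X]
    (L C : ℝ) (A : G → X → X) : Prop where
  isQuasiIsometry : ∀ g : G, IsQuasiIsometry L C (A g)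
  almost_mul : ∀ (g h : G) (x : X), dist (A g (A h x)) (A (g * h) x) ≤ C

/-- Coboundedness of a quasi-action. -/
def IsCobounded {G : Type*} {X : Type*} [MetricSpace X] (A : G → X → X) : Prop :=
  ∃ C : ℝ, 0 ≤ C ∧ ∀ x y : X, ∃ g : G, dist (A g x) y ≤ C

/-- Coarse equivariance of a map with respect to two quasi-actions. -/
def IsCoarselyEquivariant {G : Type*} {X : Type*} {Y : Type*} [MetricSpace Y]
    (A : G → X → X) (B : G → Y → Y) (f : X → Y) : Prop :=
  ∃ C : ℝ, 0 ≤ C ∧ ∀ (x : X) (g : G), dist (f (A g x)) (B g (f x)) ≤ C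

/-- Two quasi-actions are quasi-conjugate if there is a coarsely equivariant quasi-isometry. -/
def AreQuasiConjugate {G : Type*} {X : Type*} {Y : Type*} [MetricSpace X] [MetricSpace Y]
    (A : G → X → X) (B : G → Y → Y) : Prop :=
  ∃ f : X → Y, (∃ L C : ℝ, IsQuasiIsometry L C f) ∧ IsCoarselyEquivariant A B f

/-!
For a cobounded quasi-action on a tree `T`, the elements of `G` that displace a base point by a
bounded amount form a set `S` whose Cayley graph `Γ` is connected and, through the orbit map,
quasi-isometric to `T`; the metric of `Γ` is moreover invariant under left translation. Fix a vertex
`b` of `Γ` and identify two points of a sphere around `b` when they lie in the same component of the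
complement of the open ball which that sphere bounds. The quotient graph is always a tree. Two
identified points are joined by a path outside the ball, and the median of the images in `T` of `b`
and of the two points lies close both to that path and to the geodesics to `b`, so the points are
at bounded distance. Hence `Γ` is isometric to the quotient tree up to an additive error, and left
translation becomes a `(1, C')`-quasi-action on it.
-/

section Walks

open SimpleGraph

variable {V W : Type*} {G : SimpleGraph V} {H : SimpleGraph W}

theorem edist_hom_le (f : G →g H) (u v : V) : H.edist (f u) (f v) ≤ G.edist u v :=
  le_iInf fun p => by simpa only [Walk.length_map] using edist_le (p.map f)

theorem dist_iso (f : G ≃g H) (u v : V) : H.dist (f u) (f v) = G.dist u v := by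
  refine congrArg ENat.toNat ((edist_hom_le f.toHom u v).antisymm ?_)
  simpa using edist_hom_le f.symm.toHom (f u) (f v)

theorem connected_map_of_surjective (hG : G.Connected) {f : V → W} (hf : f.Surjective) :
    (G.map f).Connected := by
  have reachable_of_walk : ∀ {u v : V}, G.Walk u v → (G.map f).Reachable (f u) (f v) := by
    intro u v p
    induction p with
    | nil => exact .rfl
    | @cons u v _ h _ ih =>
      by_cases huv : f u = f v
      · rwa [huv]
      · exact (map_adj_apply' h huv).reachable.trans ih
  have := hG.nonempty.map f
  refine ⟨fun a b => ?_⟩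
  obtain ⟨u, rfl⟩ := hf a
  obtain ⟨v, rfl⟩ := hf b
  exact (hG.preconnected u v).elim reachable_of_walk

theorem dist_comp_le_mul_dist (hG : G.Connected) (hH : H.Connected) {f : V → W} {E : ℕ}
    (hf : ∀ u v, G.Adj u v → H.dist (f u) (f v) ≤ E) (u v : V) :
    H.dist (f u) (f v) ≤ E * G.dist u v := by
  obtain ⟨p, hp⟩ := hG.exists_walk_length_eq_dist u v
  rw [← hp]
  clear hp
  induction p with
  | nil => simp
  | @cons u u' v h p ih =>
    calc H.dist (f u) (f v) ≤ H.dist (f u) (f u') + H.dist (f u') (f v) := hH.dist_triangle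
      _ ≤ E + E * p.length := add_le_add (hf u u' h) ih
      _ = E * (Walk.cons h p).length := by rw [Walk.length_cons]; ring

theorem dist_add_dist_of_mem_support (hG : G.Connected) {u v z : V} {p : G.Walk u v}
    (hp : p.length = G.dist u v) (hz : z ∈ p.support) :
    G.dist u z + G.dist z v = G.dist u v := by
  classical
  refine le_antisymm ?_ hG.dist_triangle
  calc G.dist u z + G.dist z v ≤ (p.takeUntil z hz).length + (p.dropUntil z hz).length :=
        add_le_add (dist_le _) (dist_le _)
    _ = G.dist u v := by rw [← Walk.length_append, p.take_spec hz, hp]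

theorem dist_left_le_of_mem_support {u v z : V} {p : G.Walk u v} (hz : z ∈ p.support) :
    G.dist u z ≤ p.length := by
  classical
  exact (dist_le (p.takeUntil z hz)).trans (p.length_takeUntil_le_length hz)

theorem exists_adj_dist_add_one_eq (hG : G.Connected) {b u : V} (hu : u ≠ b) :
    ∃ v, G.Adj u v ∧ G.dist b v + 1 = G.dist b u := by
  obtain ⟨p, hp⟩ := hG.exists_walk_length_eq_dist u b
  cases p with
  | nil => exact absurd rfl hu
  | @cons _ v _ h p =>
    refine ⟨v, h, ?_⟩
    rw [dist_comm (u := b), dist_comm (u := b), ← hp, Walk.length_cons]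
    have hle : G.dist u b ≤ G.dist u v + G.dist v b := hG.dist_triangle
    rw [dist_eq_one_iff_adj.2 h, ← hp, Walk.length_cons] at hle
    have := dist_le p
    omega

theorem finite_setOf_dist_le (hG : G.Connected) (hfin : ∀ v, (G.neighborSet v).Finite)
    (v : V) (n : ℕ) : {a | G.dist v a ≤ n}.Finite := by
  induction n with
  | zero =>
    refine (Set.finite_singleton v).subset fun a ha => ?_
    exact (hG.dist_eq_zero_iff.1 (Nat.le_zero.1 ha)).symm
  | succ n ih =>
    refine ((Set.finite_singleton v).union (ih.biUnion fun a _ => hfin a)).subset fun a ha => ?_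
    rcases eq_or_ne a v with rfl | hav
    · exact Or.inl rfl
    · obtain ⟨c, hac, hc⟩ := exists_adj_dist_add_one_eq hG hav
      refine Or.inr (Set.mem_biUnion (x := c) ?_ hac.symm)
      rw [Set.mem_ofPred_eq] at ha ⊢
      omega

-- At the highest vertex of a cycle both neighbours along the cycle are lower, hence equal.
theorem isAcyclic_of_subsingleton_lower_neighbors {α : Type*} [LinearOrder α] (height : V → α)
    (hne : ∀ u v, G.Adj u v → height u ≠ height v)
    (hlower : ∀ u v v', G.Adj u v → G.Adj u v' → height v < height u → height v' < height u →
      v = v') :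
    G.IsAcyclic := by
  classical
  intro v c hc
  obtain ⟨top, htop, hmax⟩ := c.support.toFinset.exists_max_image height ⟨v, by simp⟩
  simp only [List.mem_toFinset] at htop hmax
  set d := c.rotate top htop
  have hd : d.IsCycle := hc.rotate htop
  have lower : ∀ w ∈ d.support, G.Adj top w → height w < height top := fun w hw h =>
    (hmax w ((c.mem_support_rotate_iff top htop).1 hw)).lt_of_ne (hne top w h).symm
  have hsnd : G.Adj top d.snd := d.adj_snd hd.not_nil
  have hpen : G.Adj top d.penultimate := (d.adj_penultimate hd.not_nil).symm
  exact hd.snd_ne_penultimate (hlower top _ _ hsnd hpen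
    (lower _ (d.getVert_mem_support _) hsnd) (lower _ (d.getVert_mem_support _) hpen))

end Walks

/-- Every walk in `G` from `a` to `b` visits `m`. -/
def Separates {V : Type*} (G : SimpleGraph V) (m a b : V) : Prop :=
  ∀ p : G.Walk a b, m ∈ p.support

namespace Separates

open SimpleGraph

variable {V W : Type*} {G : SimpleGraph V} {H : SimpleGraph W} {m a b : V}

theorem left (G : SimpleGraph V) (a b : V) : Separates G a a b :=
  fun p => p.start_mem_support

theorem symm (h : Separates G m a b) : Separates G m b a := fun p => by
  simpa only [Walk.support_reverse, List.mem_reverse] using h p.reverse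

theorem of_mem_support (hG : G.IsAcyclic) {p : G.Walk a b} (hp : p.IsPath) (hm : m ∈ p.support) :
    Separates G m a b := fun q => by
  classical
  have : p = q.toPath := congrArg Subtype.val ((hG.subsingleton_path a b).elim ⟨p, hp⟩ q.toPath)
  exact q.support_toPath_subset_support (this ▸ hm)

theorem of_adj_of_not_separates (hG : G.IsAcyclic) {o o' p q : V} (h : G.Adj o o')
    (ho' : Separates G m o' p) (hpq : Separates G m p q) (ho : ¬ Separates G m o p) :
    Separates G o p q := by
  classical
  obtain ⟨v, hv⟩ := not_forall.1 ho
  obtain rfl : m = o' := by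
    have := ho' (.cons h.symm v)
    rw [Walk.support_cons, List.mem_cons] at this
    exact this.resolve_right hv
  have hpath : (Walk.cons h.symm v.bypass).IsPath :=
    v.bypass_isPath.cons fun h' => hv (v.support_bypass_subset_support h')
  have hop : Separates G o p m := (of_mem_support hG hpath (by simp)).symm
  exact fun r => r.support_takeUntil_subset_support (hpq r) (hop _)

theorem exists_median (hG : G.IsAcyclic) {o p : V} (v : G.Walk o p) (q : V) :
    ∃ m, Separates G m o p ∧ Separates G m o q ∧ Separates G m p q := by
  induction v with
  | nil => exact ⟨_, left _ _ _, left _ _ _, left _ _ _⟩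
  | @cons o o' p h _ ih =>
    obtain ⟨m, hp, hq, hpq⟩ := ih
    by_cases hop : Separates G m o p
    · by_cases hoq : Separates G m o q
      · exact ⟨m, hop, hoq, hpq⟩
      · exact ⟨o, left _ _ _, left _ _ _, (of_adj_of_not_separates hG h hq hpq.symm hoq).symm⟩
    · exact ⟨o, left _ _ _, left _ _ _, of_adj_of_not_separates hG h hp hpq hop⟩

theorem exists_mem_support_dist_le (hG : G.Connected) {f : W → V} {E : ℕ}
    (hf : ∀ x y, H.Adj x y → G.dist (f x) (f y) ≤ E) {x y : W} (p : H.Walk x y)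
    (h : Separates G m (f x) (f y)) : ∃ z ∈ p.support, G.dist (f z) m ≤ E := by
  induction p with
  | @nil x =>
    obtain rfl : m = f x := by simpa using h .nil
    exact ⟨x, by simp, by simp⟩
  | @cons x x' y hx p ih =>
    obtain ⟨r, hr⟩ := hG.exists_walk_length_eq_dist (f x) (f x')
    by_cases hm : m ∈ r.support
    · exact ⟨x, by simp, (dist_left_le_of_mem_support hm).trans (hr.trans_le (hf _ _ hx))⟩
    · obtain ⟨z, hz, hzm⟩ := ih fun v =>
        ((Walk.mem_support_append_iff _ _).1 (h (r.append v))).resolve_left hm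
      exact ⟨z, by simp [hz], hzm⟩

end Separates

section Levels

open SimpleGraph

variable {X : Type*} (Γ : SimpleGraph X) (b : X)

/-- The complement of the open ball of radius `n` around `b`, as a spanning subgraph: the edges of
`Γ` with both ends at distance at least `n` from `b`. -/
def exterior (n : ℕ) : SimpleGraph X where
  Adj x y := Γ.Adj x y ∧ n ≤ Γ.dist b x ∧ n ≤ Γ.dist b y
  symm := ⟨fun _ _ h => ⟨h.1.symm, h.2.2, h.2.1⟩⟩
  loopless := ⟨fun _ h => Γ.irrefl h.1⟩

/-- Two vertices are equivalent if they lie on the same sphere around `b` and in the same component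
of the complement of the open ball which that sphere bounds. -/
def levelSetoid : Setoid X where
  r x y := Γ.dist b x = Γ.dist b y ∧ (exterior Γ b (Γ.dist b x)).Reachable x y
  iseqv :=
    { refl := fun _ => ⟨rfl, .rfl⟩
      symm := fun h => ⟨h.1.symm, h.1 ▸ h.2.symm⟩
      trans := fun h h' => ⟨h.1.trans h'.1, h.2.trans (h.1 ▸ h'.2)⟩ }

/-- The vertices of the tree of levels: a class of `levelSetoid` is the trace on the sphere of
radius `n` of a component of the complement of the open ball of radius `n`. -/
abbrev LevelComponent : Type _ := Quotient (levelSetoid Γ b)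

/-- The quotient graph of `Γ` on the level components, which approximates `Γ` when these have
bounded diameter. -/
def levelTree : SimpleGraph (LevelComponent Γ b) := Γ.map (Quotient.mk (levelSetoid Γ b))

variable {Γ b}

theorem exterior_anti : Antitone (exterior Γ b) :=
  fun _ _ h _ _ hxy => ⟨hxy.1, h.trans hxy.2.1, h.trans hxy.2.2⟩

theorem le_dist_of_mem_support_exterior {n : ℕ} {x y z : X} (p : (exterior Γ b n).Walk x y)
    (hx : n ≤ Γ.dist b x) (hz : z ∈ p.support) : n ≤ Γ.dist b z := by
  induction p with
  | nil => rwa [List.mem_singleton.1 hz]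
  | cons h _ ih =>
    rcases List.mem_cons.1 hz with rfl | hz
    · exact hx
    · exact ih h.2.2 hz

theorem levelSetoid_of_adj {x y : X} (hxy : Γ.Adj x y) (hd : Γ.dist b x = Γ.dist b y) :
    levelSetoid Γ b x y :=
  ⟨hd, Adj.reachable ⟨hxy, le_rfl, hd.le⟩⟩

theorem exists_ancestor (hΓ : Γ.Connected) {n : ℕ} {x : X} (hx : n ≤ Γ.dist b x) :
    ∃ y, Γ.dist b y = n ∧ n + Γ.dist x y ≤ Γ.dist b x ∧ (exterior Γ b n).Reachable x y := by
  induction hk : Γ.dist b x - n generalizing x with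
  | zero => exact ⟨x, by omega, by simpa using hx, .rfl⟩
  | succ k ih =>
    have hxb : x ≠ b := by rintro rfl; simp at hk
    obtain ⟨x', hadj, hx'⟩ := exists_adj_dist_add_one_eq hΓ hxb
    obtain ⟨y, hy, hle, hreach⟩ := ih (x := x') (by omega) (by omega)
    have hstep : (exterior Γ b n).Adj x x' := ⟨hadj, hx, by omega⟩
    have htri : Γ.dist x y ≤ Γ.dist x x' + Γ.dist x' y := hΓ.dist_triangle
    rw [dist_eq_one_iff_adj.2 hadj] at htri
    exact ⟨y, hy, by omega, hstep.reachable.trans hreach⟩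

theorem levelSetoid_of_adj_lower {x x' y y' : X} (hxx' : levelSetoid Γ b x x')
    (hxy : Γ.Adj x y) (hxy' : Γ.Adj x' y') (hy : Γ.dist b y < Γ.dist b x)
    (hy' : Γ.dist b y' < Γ.dist b x') : levelSetoid Γ b y y' := by
  obtain ⟨hlevel, hreach⟩ := hxx'
  have hdy := hxy.diff_dist_adj (u := b)
  have hdy' := hxy'.diff_dist_adj (u := b)
  have hyx : (exterior Γ b (Γ.dist b y)).Adj y x := ⟨hxy.symm, le_rfl, by omega⟩
  have hxy'' : (exterior Γ b (Γ.dist b y)).Adj x' y' := ⟨hxy', by omega, by omega⟩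
  exact ⟨by omega, hyx.reachable.trans ((hreach.mono (exterior_anti hy.le)).trans
    hxy''.reachable)⟩

namespace LevelComponent

/-- The distance from `b` of the vertices in a level component. -/
noncomputable def level : LevelComponent Γ b → ℕ :=
  Quotient.lift (Γ.dist b) fun _ _ (h : levelSetoid Γ b _ _) => h.1

end LevelComponent

theorem levelTree_isAcyclic : (levelTree Γ b).IsAcyclic := by
  refine isAcyclic_of_subsingleton_lower_neighbors LevelComponent.level ?_ ?_
  · rintro _ _ ⟨hne, x, y, hxy, rfl, rfl⟩ hlevel
    exact hne (Quotient.sound (levelSetoid_of_adj hxy hlevel))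
  · rintro _ _ _ ⟨-, x, y, hxy, rfl, rfl⟩ ⟨-, x', y', hxy', hx', rfl⟩ hy hy'
    rw [← hx'] at hy'
    exact Quotient.sound
      (levelSetoid_of_adj_lower (Quotient.exact hx'.symm) hxy hxy' hy hy')

theorem levelTree_isTree (hΓ : Γ.Connected) : (levelTree Γ b).IsTree :=
  ⟨connected_map_of_surjective hΓ Quotient.mk_surjective, levelTree_isAcyclic⟩

theorem dist_levelTree_le (hΓ : Γ.Connected) (x y : X) :
    (levelTree Γ b).dist (Quotient.mk _ x) (Quotient.mk _ y) ≤ Γ.dist x y := by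
  rw [← one_mul (Γ.dist x y)]
  refine dist_comp_le_mul_dist hΓ (levelTree_isTree hΓ).connected (fun u v huv => ?_) x y
  by_cases h : Quotient.mk (levelSetoid Γ b) u = Quotient.mk _ v
  · simp [h]
  · exact (dist_eq_one_iff_adj.2 (map_adj_apply' huv h)).le

-- A walk in the level tree lifts to `Γ` up to moving within components of exteriors; `n` is the
-- lowest level that it visits.
theorem exists_reachable_exterior_of_walk {p q : LevelComponent Γ b} (w : (levelTree Γ b).Walk p q)
    {x y : X} (hx : Quotient.mk _ x = p) (hy : Quotient.mk _ y = q) :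
    ∃ n ≤ Γ.dist b x, n ≤ Γ.dist b y ∧ (exterior Γ b n).Reachable x y ∧
      Γ.dist b x + Γ.dist b y ≤ 2 * n + w.length := by
  induction w generalizing x with
  | nil =>
    obtain ⟨hlevel, hreach⟩ : levelSetoid Γ b x y := Quotient.exact (hx.trans hy.symm)
    exact ⟨_, le_rfl, hlevel.le, hreach, by rw [Walk.length_nil]; omega⟩
  | cons h w ih =>
    have hadj := h
    obtain ⟨-, z, z', hz, rfl, rfl⟩ := hadj
    obtain ⟨n, hnz', hny, hreach, hlen⟩ := ih rfl hy
    obtain ⟨hlevel, hxz⟩ : levelSetoid Γ b x z := Quotient.exact hx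
    have hdz := hz.diff_dist_adj (u := b)
    have hstep : (exterior Γ b (min n (Γ.dist b x))).Adj z z' := ⟨hz, by omega, by omega⟩
    refine ⟨min n (Γ.dist b x), by omega, by omega, ?_, by rw [Walk.length_cons]; omega⟩
    exact (hxz.mono (exterior_anti (min_le_right _ _))).trans
      (hstep.reachable.trans (hreach.mono (exterior_anti (min_le_left _ _))))

theorem dist_le_dist_levelTree_add (hΓ : Γ.Connected) {D : ℕ}
    (hD : ∀ x y, levelSetoid Γ b x y → Γ.dist x y ≤ D) (x y : X) :
    Γ.dist x y ≤ (levelTree Γ b).dist (Quotient.mk _ x) (Quotient.mk _ y) + D := by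
  obtain ⟨w, hw⟩ := (levelTree_isTree hΓ).connected.exists_walk_length_eq_dist
    (Quotient.mk (levelSetoid Γ b) x) (Quotient.mk _ y)
  obtain ⟨n, hnx, hny, hreach, hlen⟩ := exists_reachable_exterior_of_walk w rfl rfl
  obtain ⟨x', hx', hxx', hreachx⟩ := exists_ancestor hΓ hnx
  obtain ⟨y', hy', hyy', hreachy⟩ := exists_ancestor hΓ hny
  have hx'y' : Γ.dist x' y' ≤ D := hD x' y'
    ⟨hx'.trans hy'.symm, hx' ▸ hreachx.symm.trans (hreach.trans hreachy)⟩
  have htri : Γ.dist x y ≤ Γ.dist x x' + Γ.dist x' y := hΓ.dist_triangle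
  have htri' : Γ.dist x' y ≤ Γ.dist x' y' + Γ.dist y y' := by
    rw [dist_comm (u := y)]
    exact hΓ.dist_triangle
  omega

end Levels

/-- `Γ` is a graph on a net in the graph `T`, placed in `T` by `ψ`: edges of `Γ` have length at most
`E` in `T`, the net is `K`-dense, and points of the net at distance at most `2 * K + 1` in `T` are
adjacent in `Γ`. The bound `2 * K + 1` lets a walk in `T` be shadowed by a walk in `Γ`. -/
structure IsNetGraph {X V : Type*} (Γ : SimpleGraph X) (T : SimpleGraph V) (ψ : X → V)
    (E K : ℕ) : Prop where
  dist_le_of_adj : ∀ x y, Γ.Adj x y → T.dist (ψ x) (ψ y) ≤ E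
  exists_dist_le : ∀ v, ∃ x, T.dist (ψ x) v ≤ K
  eq_or_adj : ∀ x y, T.dist (ψ x) (ψ y) ≤ 2 * K + 1 → x = y ∨ Γ.Adj x y

namespace IsNetGraph

open SimpleGraph

variable {X V : Type*} {Γ : SimpleGraph X} {T : SimpleGraph V} {ψ : X → V} {E K : ℕ}

theorem exists_walk_length_le (h : IsNetGraph Γ T ψ E K) (hT : T.Connected) {v v' : V}
    (p : T.Walk v v') {x y : X} (hx : T.dist (ψ x) v ≤ K) (hy : T.dist (ψ y) v' ≤ K) :
    ∃ w : Γ.Walk x y, w.length ≤ p.length + 1 := by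
  induction p generalizing x with
  | @nil v =>
    have hxy : T.dist (ψ x) (ψ y) ≤ T.dist (ψ x) v + T.dist v (ψ y) := hT.dist_triangle
    rw [dist_comm (u := v)] at hxy
    obtain rfl | hadj := h.eq_or_adj x y (by omega)
    · exact ⟨.nil, by simp⟩
    · exact ⟨.cons hadj .nil, by simp⟩
  | @cons v v₁ v' hv p ih =>
    obtain ⟨z, hz⟩ := h.exists_dist_le v₁
    obtain ⟨w, hw⟩ := ih hz hy
    have hxz : T.dist (ψ x) (ψ z) ≤ T.dist (ψ x) v + T.dist v (ψ z) := hT.dist_triangle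
    have hvz : T.dist v (ψ z) ≤ T.dist v v₁ + T.dist v₁ (ψ z) := hT.dist_triangle
    rw [dist_eq_one_iff_adj.2 hv, dist_comm (u := v₁)] at hvz
    obtain rfl | hadj := h.eq_or_adj x z (by omega)
    · exact ⟨w, hw.trans (by simp)⟩
    · exact ⟨.cons hadj w, by simpa using hw⟩

theorem connected [Nonempty X] (h : IsNetGraph Γ T ψ E K) (hT : T.Connected) : Γ.Connected := by
  refine ⟨fun x y => ?_⟩
  obtain ⟨p⟩ := hT.preconnected (ψ x) (ψ y)
  exact ⟨(h.exists_walk_length_le hT p (by simp) (by simp)).choose⟩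

theorem dist_le (h : IsNetGraph Γ T ψ E K) (hT : T.Connected) (x y : X) :
    Γ.dist x y ≤ T.dist (ψ x) (ψ y) + 1 := by
  obtain ⟨p, hp⟩ := hT.exists_walk_length_eq_dist (ψ x) (ψ y)
  obtain ⟨w, hw⟩ := h.exists_walk_length_le hT p (x := x) (y := y) (by simp) (by simp)
  exact (SimpleGraph.dist_le w).trans (hp ▸ hw)

theorem dist_map_le (h : IsNetGraph Γ T ψ E K) (hT : T.Connected) (x y : X) :
    T.dist (ψ x) (ψ y) ≤ E * Γ.dist x y :=
  have : Nonempty X := ⟨x⟩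
  dist_comp_le_mul_dist (h.connected hT) hT h.dist_le_of_adj x y

theorem dist_le_of_separates (h : IsNetGraph Γ T ψ E K) (hT : T.Connected) {b c z : X} {m : V}
    (hm : Separates T m (ψ b) (ψ z)) (hc : T.dist (ψ c) m ≤ E) (hz : Γ.dist b z ≤ Γ.dist b c) :
    Γ.dist z c ≤ 2 * (2 * E + 1) := by
  have : Nonempty X := ⟨b⟩
  have hΓ := h.connected hT
  obtain ⟨r, hr⟩ := hΓ.exists_walk_length_eq_dist b z
  obtain ⟨a, ha, ham⟩ := hm.exists_mem_support_dist_le hT h.dist_le_of_adj r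
  have hac : Γ.dist a c ≤ 2 * E + 1 := by
    have hψ : T.dist (ψ a) (ψ c) ≤ T.dist (ψ a) m + T.dist m (ψ c) := hT.dist_triangle
    rw [dist_comm (u := m)] at hψ
    have := h.dist_le hT a c
    omega
  have hbaz := dist_add_dist_of_mem_support hΓ hr ha
  have hbac : Γ.dist b c ≤ Γ.dist b a + Γ.dist a c := hΓ.dist_triangle
  have hzac : Γ.dist z c ≤ Γ.dist z a + Γ.dist a c := hΓ.dist_triangle
  rw [dist_comm (u := z) (v := a)] at hzac
  omega

-- The median of `ψ b`, `ψ x` and `ψ y` is met both by the exterior path from `x` to `y`, at a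
-- point no closer to `b` than `x` and `y`, and by geodesics from `b` to `x` and `y`.
theorem dist_le_of_levelSetoid (h : IsNetGraph Γ T ψ E K) (hT : T.IsTree) {b x y : X}
    (hxy : levelSetoid Γ b x y) : Γ.dist x y ≤ 4 * (2 * E + 1) := by
  have : Nonempty X := ⟨b⟩
  obtain ⟨hlevel, ⟨w⟩⟩ := hxy
  obtain ⟨p⟩ := hT.connected.preconnected (ψ b) (ψ x)
  obtain ⟨m, hbx, hby, hmxy⟩ := Separates.exists_median hT.isAcyclic p (ψ y)
  obtain ⟨c, hc, hcm⟩ := hmxy.exists_mem_support_dist_le hT.connected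
    (H := exterior Γ b (Γ.dist b x)) (fun u v huv => h.dist_le_of_adj u v huv.1) w
  have hbc := le_dist_of_mem_support_exterior w le_rfl hc
  have hxc := h.dist_le_of_separates hT.connected hbx hcm hbc
  have hyc := h.dist_le_of_separates hT.connected hby hcm (hlevel ▸ hbc)
  have htri : Γ.dist x y ≤ Γ.dist x c + Γ.dist c y := (h.connected hT.connected).dist_triangle
  rw [dist_comm (u := c)] at htri
  omega

/-- The level of a component together with the position in `T` of a chosen point of it. This code in
`ℕ × V` bounds the size of the level tree by that of `T`. -/
noncomputable def position (ψ : X → V) (b : X) (q : LevelComponent Γ b) : ℕ × V :=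
  (q.level, ψ q.out)

theorem position_injective (h : IsNetGraph Γ T ψ E K) (b : X) :
    (position ψ b : LevelComponent Γ b → ℕ × V).Injective := by
  intro p q hpq
  obtain ⟨hlevel, hψ⟩ : p.level = q.level ∧ ψ p.out = ψ q.out := Prod.ext_iff.1 hpq
  rw [← p.out_eq, ← q.out_eq] at hlevel ⊢
  rcases h.eq_or_adj p.out q.out (by simp [hψ]) with heq | hadj
  · rw [heq]
  · exact Quotient.sound (levelSetoid_of_adj hadj hlevel)

theorem finite_neighborSet_levelTree (h : IsNetGraph Γ T ψ E K) (hT : T.IsTree)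
    (hfin : ∀ v, (T.neighborSet v).Finite) (b : X) (q : LevelComponent Γ b) :
    ((levelTree Γ b).neighborSet q).Finite := by
  have : Nonempty X := ⟨b⟩
  have hΓ := h.connected hT.connected
  set n := 1 + 4 * (2 * E + 1)
  have hball : (Set.Iic (q.level + n) ×ˢ {v | T.dist (ψ q.out) v ≤ E * n}).Finite :=
    (Set.finite_Iic _).prod (finite_setOf_dist_le hT.connected hfin _ _)
  refine hball.of_injOn (f := position ψ b) (fun p hqp => ?_) (h.position_injective b).injOn
  have hdist : Γ.dist q.out p.out ≤ n := by
    have hle := dist_le_dist_levelTree_add hΓ (fun _ _ => h.dist_le_of_levelSetoid hT)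
      (b := b) q.out p.out
    have hadj : (levelTree Γ b).Adj q p := hqp
    rwa [q.out_eq, p.out_eq, dist_eq_one_iff_adj.2 hadj] at hle
  refine ⟨?_, (h.dist_map_le hT.connected _ _).trans (Nat.mul_le_mul_left E hdist)⟩
  have hlevel : Γ.dist b p.out ≤ Γ.dist b q.out + Γ.dist q.out p.out := hΓ.dist_triangle
  rw [Set.mem_Iic, position, ← q.out_eq]
  nth_rewrite 1 [← p.out_eq]
  exact hlevel.trans (Nat.add_le_add_left hdist _)

end IsNetGraph

namespace SimplicialTree

/-- A tree with a vertex set in another universe as a `SimplicialTree.{u}`, when that vertex set is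
small enough. -/
noncomputable def ofSmall {Q : Type w} [Small.{u} Q] (H : SimpleGraph Q) (hH : H.IsTree) :
    SimplicialTree.{u} where
  V := Shrink.{u} Q
  graph := H.map (equivShrink Q)
  isTree := (SimpleGraph.Iso.map (equivShrink Q) H).isTree_iff.1 hH

variable {Q : Type w} [Small.{u} Q] {H : SimpleGraph Q} (hH : H.IsTree)

theorem dist_ofSmall (p q : Q) :
    (ofSmall.{u} H hH).graph.dist (equivShrink Q p) (equivShrink Q q) = H.dist p q :=
  dist_iso (SimpleGraph.Iso.map (equivShrink Q) H) p q

theorem isCountable_ofSmall [Countable Q] : (ofSmall.{u} H hH).IsCountable :=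
  (equivShrink Q).symm.injective.countable

theorem isLocallyFinite_ofSmall (hfin : ∀ q, (H.neighborSet q).Finite) :
    (ofSmall.{u} H hH).IsLocallyFinite := by
  intro v
  let e : H ≃g (ofSmall.{u} H hH).graph := SimpleGraph.Iso.map (equivShrink Q) H
  refine (hfin (e.symm v)).of_injOn (f := e.symm) (fun v' hv' => ?_) e.symm.injective.injOn
  exact e.symm.map_rel_iff.2 hv'

end SimplicialTree

theorem IsNetGraph.exists_simplicialTree {X : Type w} [Nonempty X] {V : Type u}
    {Γ : SimpleGraph X} {T : SimpleGraph V} {ψ : X → V} {E K : ℕ} (h : IsNetGraph Γ T ψ E K)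
    (hT : T.IsTree) :
    ∃ (T' : SimplicialTree.{u}) (π : X → T'.V) (D : ℕ), π.Surjective ∧
      (∀ x y, T'.graph.dist (π x) (π y) ≤ Γ.dist x y) ∧
      (∀ x y, Γ.dist x y ≤ T'.graph.dist (π x) (π y) + D) ∧
      (Countable V → T'.IsCountable) ∧
      ((∀ v, (T.neighborSet v).Finite) → T'.IsLocallyFinite) := by
  obtain ⟨b⟩ := ‹Nonempty X›
  have hΓ := h.connected hT.connected
  have hinj := h.position_injective b
  have : Small.{u} (LevelComponent Γ b) := small_of_injective hinj
  have htree := levelTree_isTree hΓ (b := b)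
  refine ⟨.ofSmall (levelTree Γ b) htree, fun x => equivShrink _ (Quotient.mk _ x),
    4 * (2 * E + 1), (equivShrink _).surjective.comp Quotient.mk_surjective,
    fun x y => ?_, fun x y => ?_, fun _ => ?_, fun hfin => ?_⟩
  · exact (SimplicialTree.dist_ofSmall htree _ _).trans_le (dist_levelTree_le hΓ x y)
  · rw [SimplicialTree.dist_ofSmall]
    exact dist_le_dist_levelTree_add hΓ (fun _ _ => h.dist_le_of_levelSetoid hT) x y
  · have := hinj.countable
    exact SimplicialTree.isCountable_ofSmall htree
  · exact SimplicialTree.isLocallyFinite_ofSmall htree (h.finite_neighborSet_levelTree hT hfin b)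

namespace SimplicialTree

variable {T : SimplicialTree.{u}}

/-- The affine extension to the realization of the distance of a vertex to `v`. It is `1`-Lipschitz,
which bounds lengths of paths from below. -/
noncomputable def distTo (v : T.V) (p : T.Point) : ℝ :=
  p.coord.sum fun w a => a * T.graph.dist w v

theorem distTo_vertex (v w : T.V) : distTo v (T.vertex w) = T.graph.dist w v := by
  simp [distTo, vertex]

theorem OnEdge.distTo_eq {u v : T.V} {p : T.Point} (h : T.OnEdge u v p) (w : T.V) :
    distTo w p = p.coord u * T.graph.dist u w + p.coord v * T.graph.dist v w := by
  classical
  have hsupp : p.coord.support ⊆ {u, v} := fun w hw => by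
    simpa using h.2 w (Finsupp.mem_support_iff.1 hw)
  rw [distTo, Finsupp.sum_of_support_subset _ hsupp _ (by simp), Finset.sum_pair h.1.ne]

theorem OnEdge.abs_distTo_sub_le {u v : T.V} {p q : T.Point} (hp : T.OnEdge u v p)
    (hq : T.OnEdge u v q) (w : T.V) : |distTo w p - distTo w q| ≤ |p.coord u - q.coord u| := by
  have hslope : |(T.graph.dist u w : ℝ) - T.graph.dist v w| ≤ 1 := by
    rw [abs_sub_le_iff, sub_le_iff_le_add, sub_le_iff_le_add, T.graph.dist_comm (u := u),
      T.graph.dist_comm (u := v)]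
    have := hp.1.diff_dist_adj (u := w)
    constructor <;> norm_cast <;> omega
  calc |distTo w p - distTo w q|
      = |(p.coord u - q.coord u) * (T.graph.dist u w - T.graph.dist v w)| := by
        rw [hp.distTo_eq, hq.distTo_eq, eq_sub_of_add_eq' hp.add_eq_one,
          eq_sub_of_add_eq' hq.add_eq_one]
        ring_nf
    _ ≤ |p.coord u - q.coord u| := by
        rw [abs_mul]
        exact mul_le_of_le_one_right (abs_nonneg _) hslope

theorem HasPath.abs_distTo_sub_le {p q : T.Point} {l : ℝ} (h : T.HasPath p q l) (w : T.V) :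
    |distTo w p - distTo w q| ≤ l := by
  induction h with
  | nil p => simp
  | cons hp hq _ ih =>
    exact (_root_.abs_sub_le _ _ _).trans (add_le_add (hp.abs_distTo_sub_le hq w) ih)

theorem hasPath_vertex_of_walk {u v : T.V} (p : T.graph.Walk u v) :
    T.HasPath (T.vertex u) (T.vertex v) p.length := by
  classical
  induction p with
  | nil => simpa using HasPath.nil _
  | cons h p ih =>
    convert HasPath.cons (onEdge_vertex_left h) (onEdge_vertex_left h.symm).swap ih using 1
    simp [vertex, h.ne', add_comm]

theorem dist_vertex (v w : T.V) : dist (T.vertex v) (T.vertex w) = T.graph.dist v w := by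
  apply le_antisymm
  · obtain ⟨p, hp⟩ := T.isTree.connected.exists_walk_length_eq_dist v w
    exact hp ▸ pathDist_le (hasPath_vertex_of_walk p)
  · refine le_pathDist fun l hl => ?_
    simpa [distTo_vertex] using (le_abs_self _).trans (hl.abs_distTo_sub_le w)

theorem eq_vertex {u : T.V} {p : T.Point} (h : ∀ w, p.coord w ≠ 0 → w = u) : p = T.vertex u := by
  have hsupp : p.coord.support ⊆ {u} := fun w hw => by
    simpa using h w (Finsupp.mem_support_iff.1 hw)
  obtain ⟨a, ha⟩ := Finsupp.support_subset_singleton'.1 hsupp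
  have hsum := p.sum_eq_one
  rw [ha, Finsupp.sum_single_index rfl] at hsum
  ext1
  rw [ha, hsum, vertex]

theorem exists_dist_vertex_le_one (p : T.Point) : ∃ v, dist p (T.vertex v) ≤ 1 := by
  classical
  obtain ⟨u, v, rfl | huv, h⟩ := p.mem_cell
  · exact ⟨u, by simp [eq_vertex fun w hw => (h w hw).elim id id]⟩
  · have hp : T.OnEdge u v p := ⟨huv, h⟩
    refine ⟨u, (pathDist_le (.cons hp (onEdge_vertex_left huv) (.nil _))).trans ?_⟩
    have hu : (T.vertex u).coord u = 1 := by simp [vertex]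
    rw [hu, add_zero, abs_le]
    constructor <;> linarith [p.nonneg u, p.nonneg v, hp.add_eq_one]

theorem abs_dist_sub_dist_le_two {p q : T.Point} {v w : T.V} (hp : dist p (T.vertex v) ≤ 1)
    (hq : dist q (T.vertex w) ≤ 1) : |dist p q - T.graph.dist v w| ≤ 2 := by
  rw [← dist_vertex, ← Real.dist_eq]
  linarith [dist_dist_dist_le p q (T.vertex v) (T.vertex w)]

end SimplicialTree

/-- Two maps out of the same set induce coarsely equivalent pseudometrics on it, with an affine
comparison of slope and offset `M`. -/
structure AreCoarselyEquivalent {S X Y : Type*} [MetricSpace X] [MetricSpace Y] (M : ℝ)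
    (α : S → X) (β : S → Y) : Prop where
  one_le : 1 ≤ M
  dist_left_le : ∀ s t, dist (α s) (α t) ≤ M * dist (β s) (β t) + M
  dist_right_le : ∀ s t, dist (β s) (β t) ≤ M * dist (α s) (α t) + M

theorem AreCoarselyEquivalent.exists_isQuasiIsometry {S X Y : Type*} [MetricSpace X] [MetricSpace Y]
    {M K K' : ℝ} {α : S → X} {β : S → Y} (h : AreCoarselyEquivalent M α β) (hK : 0 ≤ K)
    (hK' : 0 ≤ K') (hα : ∀ x, ∃ s, dist (α s) x ≤ K) (hβ : ∀ y, ∃ s, dist (β s) y ≤ K') :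
    ∃ f : X → Y, (∃ L C, IsQuasiIsometry L C f) ∧
      ∀ x s, dist (f x) (β s) ≤ M * (K + dist x (α s)) + M := by
  have hM : 0 < M := one_pos.trans_le h.one_le
  choose γ hγ using hα
  have hclose : ∀ x s, dist (β (γ x)) (β s) ≤ M * (K + dist x (α s)) + M := fun x s =>
    (h.dist_right_le _ _).trans (by gcongr; linarith [dist_triangle (α (γ x)) x (α s), hγ x])
  refine ⟨fun x => β (γ x), ⟨M, M * (2 * K + 2) + K', h.one_le, by positivity, ?lower, ?upper,
    ?surjective⟩, hclose⟩
  case lower =>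
    intro x y
    rw [sub_le_iff_le_add, one_div, inv_mul_le_iff₀ hM]
    have hconst : 2 * K + M ≤ M * (M * (2 * K + 2) + K') := by
      nlinarith [h.one_le, mul_nonneg hM.le hK, mul_nonneg hM.le hK', mul_self_nonneg (M - 1)]
    linarith [h.dist_left_le (γ x) (γ y), hγ x, hγ y, dist_comm x (α (γ x)),
      dist_triangle4 x (α (γ x)) (α (γ y)) y]
  case upper =>
    intro x y
    have hy : dist x (α (γ y)) ≤ dist x y + K := by
      linarith [dist_triangle x y (α (γ y)), hγ y, dist_comm y (α (γ y))]
    linarith [hclose x (γ y), mul_le_mul_of_nonneg_left hy hM.le]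
  case surjective =>
    intro y
    obtain ⟨s, hs⟩ := hβ y
    refine ⟨α s, ?_⟩
    have := hclose (α s) s
    rw [dist_self, add_zero] at this
    linarith [dist_triangle (β (γ (α s))) (β s) y, mul_nonneg hM.le hK]

section QuasiAction

variable {G : Type*} [Group G] {X Y : Type*} [MetricSpace X] [MetricSpace Y]

/-- `α` is an orbit map of the quasi-action `A` up to an error `K`, with `K`-dense image. -/
structure IsCoarseOrbitMap (A : G → X → X) (K : ℝ) (α : G → X) : Prop where
  exists_dist_le : ∀ x, ∃ g, dist (α g) x ≤ K
  dist_map_mul_le : ∀ g h, dist (A g (α h)) (α (g * h)) ≤ K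

theorem IsCoarseOrbitMap.nonneg {A : G → X → X} {K : ℝ} {α : G → X}
    (hα : IsCoarseOrbitMap A K α) : 0 ≤ K :=
  dist_nonneg.trans (hα.dist_map_mul_le 1 1)

namespace IsQuasiAction

variable {L C L' C' K K' M : ℝ} {A : G → X → X} {B : G → Y → Y}

theorem exists_isCoarseOrbitMap (hA : IsQuasiAction L C A) (hcb : IsCobounded A) (x : X) :
    ∃ K, IsCoarseOrbitMap A K fun g => A g x := by
  obtain ⟨κ, -, hκ⟩ := hcb
  exact ⟨max κ C, fun y => (hκ x y).imp fun _ hg => hg.trans (le_max_left _ _),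
    fun g h => (hA.almost_mul g h x).trans (le_max_right _ _)⟩

theorem areQuasiConjugate (hA : IsQuasiAction L C A) (hB : IsQuasiAction L' C' B) {α : G → X}
    {β : G → Y} (hα : IsCoarseOrbitMap A K α) (hβ : IsCoarseOrbitMap B K' β)
    (h : AreCoarselyEquivalent M α β) : AreQuasiConjugate A B := by
  have hL : 0 ≤ L := zero_le_one.trans (hA.isQuasiIsometry 1).one_le
  have hL' : 0 ≤ L' := zero_le_one.trans (hB.isQuasiIsometry 1).one_le
  have hM : 0 ≤ M := zero_le_one.trans h.one_le
  have hC := (hA.isQuasiIsometry 1).nonneg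
  have hC' := (hB.isQuasiIsometry 1).nonneg
  have hK := hα.nonneg
  have hK' := hβ.nonneg
  obtain ⟨f, hf, hfβ⟩ :=
    h.exists_isQuasiIsometry hK hK' hα.exists_dist_le hβ.exists_dist_le
  refine ⟨f, hf, M * (K + (L * K + C + K)) + M + K' + (L' * (M * (K + K) + M) + C'),
    by positivity, fun x g => ?_⟩
  obtain ⟨k, hk⟩ := hα.exists_dist_le x
  rw [dist_comm] at hk
  have hAx : dist (A g x) (α (g * k)) ≤ L * K + C + K := by
    have := (hA.isQuasiIsometry g).upper x (α k)
    linarith [dist_triangle (A g x) (A g (α k)) (α (g * k)), hα.dist_map_mul_le g k,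
      mul_le_mul_of_nonneg_left hk hL]
  have hfx : dist (f x) (β k) ≤ M * (K + K) + M := (hfβ x k).trans (by gcongr)
  calc dist (f (A g x)) (B g (f x))
      ≤ dist (f (A g x)) (β (g * k)) + dist (β (g * k)) (B g (β k)) +
        dist (B g (β k)) (B g (f x)) := dist_triangle4 _ _ _ _
    _ ≤ (M * (K + (L * K + C + K)) + M) + K' + (L' * (M * (K + K) + M) + C') := by
      gcongr
      · exact (hfβ _ _).trans (by gcongr)
      · exact (dist_comm _ _).trans_le (hβ.dist_map_mul_le g k)
      · refine ((hB.isQuasiIsometry g).upper _ _).trans ?_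
        rw [dist_comm (β k)]
        gcongr

theorem dist_orbit_mul_le_displacement (hA : IsQuasiAction L C A) (x : X) (g h : G) :
    dist (A g x) (A (g * h) x) ≤ L * dist (A h x) x + 2 * C := by
  linarith [hA.almost_mul g h x, (hA.isQuasiIsometry g).upper (A h x) x,
    dist_triangle_left (A g x) (A (g * h) x) (A g (A h x)), (hA.isQuasiIsometry g).nonneg]

theorem displacement_le_dist_orbit_mul (hA : IsQuasiAction L C A) (x : X) (g h : G) :
    dist (A h x) x ≤ L * (dist (A g x) (A (g * h) x) + 2 * C) := by
  have hL : 0 < L := one_pos.trans_le (hA.isQuasiIsometry g).one_le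
  rw [← inv_mul_le_iff₀ hL, ← one_div]
  linarith [hA.almost_mul g h x, (hA.isQuasiIsometry g).lower (A h x) x,
    dist_triangle_right (A g (A h x)) (A g x) (A (g * h) x)]

end IsQuasiAction

/-- `θ` is a rough isometry (multiplicative constant `1`, additive constant `D`) from a set with
distance function `δ` to `Y`, with coarse inverse `τ`. -/
structure IsRoughParametrization {S : Type*} (δ : S → S → ℝ) (D : ℝ) (θ : S → Y) (τ : Y → S) :
    Prop where
  abs_dist_sub_le : ∀ s t, |dist (θ s) (θ t) - δ s t| ≤ D
  dist_le : ∀ y, dist (θ (τ y)) y ≤ D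

/-- Left translation on `G`, transported to `Y` by `θ` and its coarse inverse `τ`. -/
def translationAction {Y : Type*} (θ : G → Y) (τ : Y → G) (g : G) (y : Y) : Y := θ (g * τ y)

namespace IsRoughParametrization

variable {δ : G → G → ℝ} {D : ℝ} {θ : G → Y} {τ : Y → G}

theorem abs_dist_mul_sub_dist_le (h : IsRoughParametrization δ D θ τ)
    (hδ : ∀ g x y, δ (g * x) (g * y) = δ x y) (g x y : G) :
    |dist (θ (g * x)) (θ (g * y)) - dist (θ x) (θ y)| ≤ 2 * D := by
  have hg := h.abs_dist_sub_le (g * x) (g * y)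
  rw [hδ] at hg
  have hxy := h.abs_dist_sub_le x y
  rw [abs_le] at *
  constructor <;> linarith

theorem dist_translationAction_le (h : IsRoughParametrization δ D θ τ)
    (hδ : ∀ g x y, δ (g * x) (g * y) = δ x y) (g x : G) :
    dist (translationAction θ τ g (θ x)) (θ (g * x)) ≤ 3 * D := by
  change dist (θ (g * τ (θ x))) (θ (g * x)) ≤ 3 * D
  linarith [(abs_le.1 (h.abs_dist_mul_sub_dist_le hδ g (τ (θ x)) x)).2, h.dist_le (θ x)]

theorem isCoarseOrbitMap (h : IsRoughParametrization δ D θ τ)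
    (hδ : ∀ g x y, δ (g * x) (g * y) = δ x y) :
    IsCoarseOrbitMap (translationAction θ τ) (3 * D) θ where
  exists_dist_le y := by
    have hD : 0 ≤ D := dist_nonneg.trans (h.dist_le y)
    exact ⟨τ y, by linarith [h.dist_le y]⟩
  dist_map_mul_le := h.dist_translationAction_le hδ

theorem isQuasiAction (h : IsRoughParametrization δ D θ τ)
    (hδ : ∀ g x y, δ (g * x) (g * y) = δ x y) :
    IsQuasiAction 1 (4 * D) (translationAction θ τ) := by
  have hD : 0 ≤ D := dist_nonneg.trans (h.dist_le (θ 1))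
  have hτ : ∀ p q, |dist (θ (τ p)) (θ (τ q)) - dist p q| ≤ 2 * D := fun p q => by
    rw [← Real.dist_eq]
    linarith [dist_dist_dist_le (θ (τ p)) (θ (τ q)) p q, h.dist_le p, h.dist_le q]
  have hact : ∀ g p q,
      |dist (translationAction θ τ g p) (translationAction θ τ g q) - dist p q| ≤ 4 * D :=
    fun g p q => by
      change |dist (θ (g * τ p)) (θ (g * τ q)) - dist p q| ≤ 4 * D
      linarith [h.abs_dist_mul_sub_dist_le hδ g (τ p) (τ q), hτ p q,
        abs_sub_le (dist (θ (g * τ p)) (θ (g * τ q))) (dist (θ (τ p)) (θ (τ q))) (dist p q)]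
  refine ⟨fun g => ⟨le_rfl, by positivity, fun p q => ?_, fun p q => ?_, fun p => ?_⟩,
    fun g k p => ?_⟩
  · linarith [(abs_le.1 (hact g p q)).1]
  · linarith [(abs_le.1 (hact g p q)).2]
  · refine ⟨θ (g⁻¹ * τ p), ?_⟩
    have hinv := h.dist_translationAction_le hδ g (g⁻¹ * τ p)
    rw [mul_inv_cancel_left] at hinv
    linarith [dist_triangle (translationAction θ τ g (θ (g⁻¹ * τ p))) (θ (τ p)) p, h.dist_le p]
  · have hmul := h.dist_translationAction_le hδ g (k * τ p)
    rw [← mul_assoc] at hmul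
    exact hmul.trans (by linarith)

end IsRoughParametrization

end QuasiAction

theorem SimplicialTree.exists_isRoughParametrization {T : SimplicialTree.{u}} {S : Type*}
    {Γ : SimpleGraph S} {π : S → T.V} {D : ℕ} (hπ : π.Surjective)
    (hle : ∀ s t, T.graph.dist (π s) (π t) ≤ Γ.dist s t)
    (hge : ∀ s t, Γ.dist s t ≤ T.graph.dist (π s) (π t) + D) :
    ∃ τ, IsRoughParametrization (fun s t => (Γ.dist s t : ℝ)) (D + 1)
      (fun s => T.vertex (π s)) τ := by
  have hτ : ∀ p, ∃ s, dist (T.vertex (π s)) p ≤ D + 1 := fun p => by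
    obtain ⟨v, hv⟩ := exists_dist_vertex_le_one p
    obtain ⟨s, rfl⟩ := hπ v
    exact ⟨s, by rw [dist_comm]; linarith [D.cast_nonneg (α := ℝ)]⟩
  choose τ hτ using hτ
  refine ⟨τ, fun s t => ?_, hτ⟩
  have hle' : (T.graph.dist (π s) (π t) : ℝ) ≤ Γ.dist s t := by exact_mod_cast hle s t
  have hge' : (Γ.dist s t : ℝ) ≤ T.graph.dist (π s) (π t) + D := by exact_mod_cast hge s t
  rw [dist_vertex, abs_le]
  constructor <;> linarith [D.cast_nonneg (α := ℝ)]

theorem dist_mulCayley_mul_left {G : Type*} [Group G] (S : Set G) (g x y : G) :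
    (SimpleGraph.mulCayley S).dist (g * x) (g * y) = (SimpleGraph.mulCayley S).dist x y :=
  dist_iso ⟨Equiv.mulLeft g, SimpleGraph.mulCayley_adj_mul_iff_right⟩ x y

theorem IsQuasiAction.exists_isNetGraph {G : Type*} [Group G] {T : SimplicialTree.{u}} {L C : ℝ}
    {A : G → T.Point → T.Point} (hA : IsQuasiAction L C A) (hcb : IsCobounded A) (x : T.Point) :
    ∃ (S : Set G) (ψ : G → T.V) (E K : ℕ),
      IsNetGraph (SimpleGraph.mulCayley S) T.graph ψ E K ∧
        ∀ g, dist (A g x) (T.vertex (ψ g)) ≤ 1 := by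
  have hL : 0 ≤ L := zero_le_one.trans (hA.isQuasiIsometry 1).one_le
  obtain ⟨κ, -, hκ⟩ := hcb
  choose ψ hψ using fun g => SimplicialTree.exists_dist_vertex_le_one (A g x)
  have hdist := fun g h => abs_le.1 (SimplicialTree.abs_dist_sub_dist_le_two (hψ g) (hψ h))
  obtain ⟨K, hK⟩ := exists_nat_ge (κ + 1)
  -- The displacement of `k` when `A g x` and `A (g * k) x` are at distance at most `2 * K + 3`.
  set R := L * (2 * K + 3 + 2 * C)
  obtain ⟨E, hE⟩ := exists_nat_ge (L * R + 2 * C + 2)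
  have hgen : ∀ g k, dist (A k x) x ≤ R → T.graph.dist (ψ g) (ψ (g * k)) ≤ E := fun g k hk => by
    have : (T.graph.dist (ψ g) (ψ (g * k)) : ℝ) ≤ E := by
      linarith [(hdist g (g * k)).1, hA.dist_orbit_mul_le_displacement x g k,
        mul_le_mul_of_nonneg_left hk hL]
    exact_mod_cast this
  refine ⟨{k | dist (A k x) x ≤ R}, ψ, E, K, ⟨fun g h hgh => ?_, fun v => ?_, fun g h hgh => ?_⟩,
    hψ⟩
  · obtain ⟨-, k, hk, rfl | rfl⟩ := (SimpleGraph.mulCayley_adj' _ _ _).1 hgh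
    · exact hgen g k hk
    · exact SimpleGraph.dist_comm.trans_le (hgen h k hk)
  · obtain ⟨g, hg⟩ := hκ x (T.vertex v)
    have : (T.graph.dist (ψ g) v : ℝ) ≤ K := by
      rw [← SimplicialTree.dist_vertex]
      linarith [dist_triangle_left (T.vertex (ψ g)) (T.vertex v) (A g x), hψ g]
    exact ⟨g, by exact_mod_cast this⟩
  · refine or_iff_not_imp_left.2 fun hne => (SimpleGraph.mulCayley_adj' _ _ _).2
      ⟨hne, g⁻¹ * h, ?_, Or.inl (mul_inv_cancel_left g h)⟩
    have hgh' : (T.graph.dist (ψ g) (ψ h) : ℝ) ≤ 2 * K + 1 := by exact_mod_cast hgh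
    have horbit := hA.displacement_le_dist_orbit_mul x g (g⁻¹ * h)
    rw [mul_inv_cancel_left] at horbit
    exact horbit.trans (mul_le_mul_of_nonneg_left (by linarith [(hdist g h).2]) hL)

theorem IsNetGraph.areCoarselyEquivalent {S Y : Type*} [MetricSpace Y] {T : SimplicialTree.{u}}
    {Γ : SimpleGraph S} {ψ : S → T.V} {E K : ℕ} (h : IsNetGraph Γ T.graph ψ E K) {α : S → T.Point}
    (hα : ∀ s, dist (α s) (T.vertex (ψ s)) ≤ 1) {D : ℝ} {θ : S → Y} (hD : 0 ≤ D)
    (hθ : ∀ s t, |dist (θ s) (θ t) - Γ.dist s t| ≤ D) :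
    AreCoarselyEquivalent ((E + 1) * (D + 3)) α θ := by
  have hE := E.cast_nonneg (α := ℝ)
  have hED := mul_nonneg hE hD
  have hαψ := fun s t => abs_le.1 (SimplicialTree.abs_dist_sub_dist_le_two (hα s) (hα t))
  have hθΓ := fun s t => abs_le.1 (hθ s t)
  refine ⟨by linarith, fun s t => ?_, fun s t => ?_⟩
  · have hψ : (T.graph.dist (ψ s) (ψ t) : ℝ) ≤ E * Γ.dist s t := by
      exact_mod_cast h.dist_map_le T.isTree.connected s t
    calc dist (α s) (α t) ≤ E * Γ.dist s t + 2 := by linarith [(hαψ s t).2]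
      _ ≤ E * (dist (θ s) (θ t) + D) + 2 := by gcongr; linarith [(hθΓ s t).1]
      _ = E * dist (θ s) (θ t) + (E * D + 2) := by ring
      _ ≤ (E + 1) * (D + 3) * dist (θ s) (θ t) + (E + 1) * (D + 3) := by gcongr <;> linarith
  · have hψ : (Γ.dist s t : ℝ) ≤ T.graph.dist (ψ s) (ψ t) + 1 := by
      exact_mod_cast h.dist_le T.isTree.connected s t
    calc dist (θ s) (θ t) ≤ Γ.dist s t + D := by linarith [(hθΓ s t).2]
      _ ≤ 1 * dist (α s) (α t) + (D + 3) := by linarith [(hαψ s t).1]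
      _ ≤ (E + 1) * (D + 3) * dist (α s) (α t) + (E + 1) * (D + 3) := by gcongr <;> linarith

theorem mainTheorem9_general {G : Type w} [Group G] (T : SimplicialTree.{u}) {L C : ℝ}
    {A : G → T.Point → T.Point} (hA : IsQuasiAction L C A) (hcb : IsCobounded A) :
    ∃ T' : SimplicialTree.{u}, (T.IsCountable → T'.IsCountable) ∧
      (T.IsLocallyFinite → T'.IsLocallyFinite) ∧
      ∃ (C' : ℝ) (A' : G → T'.Point → T'.Point),
        IsQuasiAction 1 C' A' ∧ AreQuasiConjugate A A' := by
  obtain ⟨v₀⟩ := T.isTree.connected.nonempty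
  obtain ⟨S, ψ, E, K, hnet, hψ⟩ := hA.exists_isNetGraph hcb (T.vertex v₀)
  obtain ⟨K', hα⟩ := hA.exists_isCoarseOrbitMap hcb (T.vertex v₀)
  obtain ⟨T', π, D, hπ, hle, hge, hcount, hfin⟩ := hnet.exists_simplicialTree T.isTree
  obtain ⟨τ, hθ⟩ := SimplicialTree.exists_isRoughParametrization hπ hle hge
  have hinv : ∀ g x y : G, ((SimpleGraph.mulCayley S).dist (g * x) (g * y) : ℝ) =
      (SimpleGraph.mulCayley S).dist x y :=
    fun g x y => congrArg Nat.cast (dist_mulCayley_mul_left S g x y)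
  have hA' := hθ.isQuasiAction hinv
  exact ⟨T', hcount, hfin, _, _, hA', hA.areQuasiConjugate hA' hα (hθ.isCoarseOrbitMap hinv)
    (hnet.areCoarselyEquivalent hψ (by positivity) hθ.abs_dist_sub_le)⟩

theorem mainTheorem9 (G : Type w) [Group G] [Group.FG G] :
    (∀ T : SimplicialTree.{u}, T.IsCountable →
      ∀ (L C : ℝ) (A : G → T.Point → T.Point), IsQuasiAction L C A → IsCobounded A →
        ∃ T' : SimplicialTree.{u}, T'.IsCountable ∧
          ∃ (C' : ℝ) (A' : G → T'.Point → T'.Point),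
            IsQuasiAction 1 C' A' ∧ AreQuasiConjugate A A') ∧
    (∀ T : SimplicialTree.{u}, T.IsLocallyFinite →
      ∀ (L C : ℝ) (A : G → T.Point → T.Point), IsQuasiAction L C A → IsCobounded A →
        ∃ T' : SimplicialTree.{u}, T'.IsLocallyFinite ∧
          ∃ (C' : ℝ) (A' : G → T'.Point → T'.Point),
            IsQuasiAction 1 C' A' ∧ AreQuasiConjugate A A') := by
  constructor
  · intro T hT L C A hA hcb
    obtain ⟨T', hcount, -, hA'⟩ := mainTheorem9_general T hA hcb
    exact ⟨T', hcount hT, hA'⟩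
  · intro T hT L C A hA hcb
    obtain ⟨T', -, hfin, hA'⟩ := mainTheorem9_general T hA hcb
    exact ⟨T', hfin hT, hA'⟩
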